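/- There is an absolute constant $\gamma\in(0,1)$ such that the following holds. Let $a_1,\dots,a_N$ be independent random vectors in $\mathbb{C}^n$, $a_i=(a_{i,k})_{k=1}^n$, such that for every $i$ the $2n$ real random variables $\operatorname{Re}(a_{i,k}),\operatorname{Im}(a_{i,k})$, $k=1,\dots,n$, are independent, with $$\mathbb{E}\operatorname{Re}(a_{i,k})=\mathbb{E}\operatorname{Im}(a_{i,k})=0,\qquad \mathbb{E}\operatorname{Re}(a_{i,k})^2=\mathbb{E}\operatorname{Im}(a_{i,k})^2=\tfrac12 ,$$ and let $\psi_2\ge 1$ be an upper bound for the subgaussian norms $\|\operatorname{Re}(a_{i,k})\|_{\psi_2}$ and $\|\operatorname{Im}(a_{i,k})\|_{\psi_2}$ for all $i,k$, where $\|X\|_{\psi_2}:=\inf\{t>0:\mathbb{E}\exp(|X|^2/t^2)\le 2\}$ for a real random variable $X$. Put $m:=2n(n-1)$, let $P:\mathbb{C}^{n\times n}\to\mathbb{R}^m$ be the operator that maps a matrix to the vector of the real and imaginary parts of all its off-diagonal entries, scaled by $\sqrt2$, and set $X_i:=P(a_ia_i^*)$. Then $\mathbb{E}\|X_i\|_2^2=m$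 for every $i$, and if $n\ge\psi_2^4$, then for every $i$ and every $\omega\in[0,1]$ $$\mathbb{P}\left(\left|\|X_i\|_2^2-m\right|\ge m\omega\right)\le 2\exp\left(-\gamma\,\frac{\omega^2}{\psi_2^4}\,n\right).$$ -/

import Mathlib

open MeasureTheory ProbabilityTheory
open scoped ENNReal

noncomputable section

/-- The Orlicz norm `‖X‖_{ψ_r} = inf {t > 0 : E exp (|X|^r / t^r) ≤ 2}` of a real random variable,
as an extended nonnegative real (so it is `∞` if there is no such `t`). The expectation is taken
in `[0, ∞]`. -/
def psiNorm {Ω : Type*} [MeasurableSpace Ω] (r : ℝ) (X : Ω → ℝ) (μ : Measure Ω) : ℝ≥0∞ :=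
  ⨅ (t : ℝ) (_ : 0 < t ∧ ∫⁻ x, ENNReal.ofReal (Real.exp (|X x| ^ r / t ^ r)) ∂μ ≤ 2),
    ENNReal.ofReal t

/-- The positions of the off-diagonal entries of an `n × n` matrix. -/
abbrev OffDiag (n : ℕ) : Type := {p : Fin n × Fin n // p.1 ≠ p.2}

/-- The operator `P : ℂ^{n×n} → ℝ^{2n(n-1)}` that maps a matrix to the vector of the real and
imaginary parts of all its off-diagonal entries, scaled by `√2`. -/
def offDiagOp (n : ℕ) :
    Matrix (Fin n) (Fin n) ℂ →ₗ[ℝ] EuclideanSpace ℝ (OffDiag n ⊕ OffDiag n) where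
  toFun M := WithLp.toLp 2 (Sum.elim
    (fun p => Real.sqrt 2 * (M p.1.1 p.1.2).re)
    (fun p => Real.sqrt 2 * (M p.1.1 p.1.2).im))
  map_add' A B := by
    ext p
    rcases p with p | p <;> simp [mul_add]
  map_smul' c A := by
    ext p
    rcases p with p | p <;> simp <;> ring

/-- `a 0, …, a (N-1)` are independent random vectors in `ℂ^n`; for each of them the `2n` real
and imaginary parts of its coordinates are independent and centred, with second moment `1/2`
and subgaussian norm at most `ψ`, where `ψ ≥ 1`. -/
structure SubgaussianModel {Ω : Type*} [MeasurableSpace Ω] (μ : Measure Ω) {N n : ℕ}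
    (a : Fin N → Ω → Fin n → ℂ) (ψ : ℝ) : Prop where
  measurable : ∀ i, Measurable (a i)
  indep_vectors : iIndepFun a μ
  indep_parts : ∀ i, iIndepFun
    (Sum.elim (fun (k : Fin n) x => (a i x k).re) (fun (k : Fin n) x => (a i x k).im)) μ
  mean_re : ∀ i k, ∫ x, (a i x k).re ∂μ = 0
  mean_im : ∀ i k, ∫ x, (a i x k).im ∂μ = 0
  sq_re : ∀ i k, ∫ x, (a i x k).re ^ 2 ∂μ = 1 / 2
  sq_im : ∀ i k, ∫ x, (a i x k).im ^ 2 ∂μ = 1 / 2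
  one_le : 1 ≤ ψ
  psi_re : ∀ i k, psiNorm 2 (fun x => (a i x k).re) μ ≤ ENNReal.ofReal ψ
  psi_im : ∀ i k, psiNorm 2 (fun x => (a i x k).im) μ ≤ ENNReal.ofReal ψ

/-- The random vector `P (v v^*)` for a random vector `v` in `ℂ^n`. -/
def outerOffDiag {Ω : Type*} {n : ℕ} (v : Ω → Fin n → ℂ) (x : Ω) :
    EuclideanSpace ℝ (OffDiag n ⊕ OffDiag n) :=
  offDiagOp n (Matrix.vecMulVec (v x) (star (v x)))

end

/-! With `b k = |a_k|²`, the energy `‖X_i‖²` is `2((∑ b)² - ∑ b²)`, so it is controlled by one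
linear statistic and a diagonal correction. Each product `b k * b l` with `k ≠ l` has mean 1 by
independence, which gives the expectation. For the tail, `∑ b` is a sum of `2n` independent squares
and lies within `nω/8` of `n` by Bernstein (`measureReal_sum_sq_sub_ge_le`). The correction obeys `∑
b² ≤ (max b) ∑ b`, and a union bound keeps `max b` below `nω/32`. On these events
`abs_two_mul_sub_lt` applies. The union bound costs a factor of order `n`, which `exp_tail_combine`
absorbs once `ω²n/ψ⁴` is large; otherwise the claimed bound is at least 1. -/

open Finset in
theorem sum_offDiag_mul {n : ℕ} (b : Fin n → ℝ) :
    ∑ p : OffDiag n, b p.1.1 * b p.1.2 = (∑ k, b k) ^ 2 - ∑ k, b k ^ 2 := by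
  have h1 : ∑ p : OffDiag n, b p.1.1 * b p.1.2
      = ∑ p ∈ (univ : Finset (Fin n × Fin n)) with p.1 ≠ p.2, b p.1 * b p.2 := by
    rw [← Finset.sum_subtype_eq_sum_filter]
    simp
  have h2 := Finset.sum_filter_add_sum_filter_not (univ : Finset (Fin n × Fin n))
    (fun p => p.1 = p.2) (fun p => b p.1 * b p.2)
  have h3 : ∑ p ∈ (univ : Finset (Fin n × Fin n)) with p.1 = p.2, b p.1 * b p.2
      = ∑ k, b k ^ 2 := by
    rw [Finset.sum_filter, Fintype.sum_prod_type]
    simp [sq]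
  have h4 : ∑ p : Fin n × Fin n, b p.1 * b p.2 = (∑ k, b k) ^ 2 := by
    rw [sq, Finset.sum_mul_sum, Fintype.sum_prod_type]
  rw [h1]
  linarith

theorem norm_sq_outerOffDiag {Ω : Type*} {n : ℕ} (v : Ω → Fin n → ℂ) (x : Ω) :
    ‖outerOffDiag v x‖ ^ 2 = 2 * ∑ p : OffDiag n,
      ((v x p.1.1).re ^ 2 + (v x p.1.1).im ^ 2) * ((v x p.1.2).re ^ 2 + (v x p.1.2).im ^ 2) := by
  rw [EuclideanSpace.norm_sq_eq, Fintype.sum_sum_type, ← Finset.sum_add_distrib, Finset.mul_sum]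
  refine Finset.sum_congr rfl fun p _ => ?_
  simp only [outerOffDiag, offDiagOp, LinearMap.coe_mk, AddHom.coe_mk, Sum.elim_inl, Sum.elim_inr,
    Real.norm_eq_abs, sq_abs, Matrix.vecMulVec_apply, Pi.star_apply, Complex.mul_re,
    Complex.mul_im, Complex.star_def, Complex.conj_re, Complex.conj_im, mul_pow,
    Real.sq_sqrt (zero_le_two : (0 : ℝ) ≤ 2)]
  ring

theorem sq_le_two_mul_exp {v : ℝ} (hv : 0 ≤ v) : v ^ 2 ≤ 2 * Real.exp v := by
  have := Real.quadratic_le_exp_of_nonneg hv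
  nlinarith

theorem exp_le_one_add_add_sq_mul_exp_abs (u : ℝ) :
    Real.exp u ≤ 1 + u + u ^ 2 * Real.exp |u| := by
  have h0 : Real.exp u - 1 ≤ u * Real.exp u := by
    have h1 := Real.add_one_le_exp (-u)
    have h2 : Real.exp (-u) * Real.exp u = 1 := by rw [← Real.exp_add]; simp
    nlinarith [Real.exp_pos u]
  have h1 := Real.add_one_le_exp u
  rcases le_total 0 u with hu | hu
  · rw [abs_of_nonneg hu]
    nlinarith
  · have h2 : 1 ≤ Real.exp |u| := Real.one_le_exp (abs_nonneg u)
    nlinarith [mul_nonneg (sq_nonneg u) (sub_nonneg.2 h2)]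

/-! ### Exponential moments and Bernstein's inequality for squares -/

section Subexponential

variable {Ω : Type*} [MeasurableSpace Ω] {μ : Measure Ω}

theorem lintegral_exp_sq_le_of_psiNorm_le {X : Ω → ℝ} {ψ : ℝ} (hψ : 0 < ψ)
    (h : psiNorm 2 X μ ≤ ENNReal.ofReal ψ) :
    ∫⁻ x, ENNReal.ofReal (Real.exp (X x ^ 2 / (4 * ψ ^ 2))) ∂μ ≤ 2 := by
  -- The infimum need not be attained at `ψ`; doubling yields an admissible `t`, whence the scale
  -- `4ψ²`.
  have hlt : psiNorm 2 X μ < ENNReal.ofReal (2 * ψ) :=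
    h.trans_lt ((ENNReal.ofReal_lt_ofReal_iff (by positivity)).2 (by linarith))
  simp only [psiNorm, iInf_lt_iff] at hlt
  obtain ⟨t, ⟨ht, hint⟩, hlt⟩ := hlt
  have ht2 : t < 2 * ψ := (ENNReal.ofReal_lt_ofReal_iff (by positivity)).1 hlt
  refine le_trans (lintegral_mono fun x => ?_) hint
  refine ENNReal.ofReal_le_ofReal (Real.exp_le_exp.2 ?_)
  rw [Real.rpow_two, Real.rpow_two, sq_abs]
  refine div_le_div_of_nonneg_left (sq_nonneg _) (by positivity) ?_
  nlinarith

theorem integrable_exp_sq_div {X : Ω → ℝ} {s : ℝ} (hX : Measurable X)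
    (h : ∫⁻ x, ENNReal.ofReal (Real.exp (X x ^ 2 / s)) ∂μ ≤ 2) :
    Integrable (fun x => Real.exp (X x ^ 2 / s)) μ := by
  refine ⟨by fun_prop, ?_⟩
  rw [hasFiniteIntegral_iff_ofReal (.of_forall fun x => (Real.exp_pos _).le)]
  exact h.trans_lt (by simp)

theorem integral_exp_sq_div_le {X : Ω → ℝ} {s : ℝ} (hX : Measurable X)
    (h : ∫⁻ x, ENNReal.ofReal (Real.exp (X x ^ 2 / s)) ∂μ ≤ 2) :
    ∫ x, Real.exp (X x ^ 2 / s) ∂μ ≤ 2 := by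
  rw [integral_eq_lintegral_of_nonneg_ae (.of_forall fun x => (Real.exp_pos _).le) (by fun_prop)]
  exact ENNReal.toReal_le_of_le_ofReal zero_le_two (by simpa using h)

theorem measureReal_sq_ge_le {X : Ω → ℝ} {s : ℝ} (hs : 0 < s) (hX : Measurable X)
    (h : ∫⁻ x, ENNReal.ofReal (Real.exp (X x ^ 2 / s)) ∂μ ≤ 2) (r : ℝ) :
    μ.real {x | r ≤ X x ^ 2} ≤ 2 * Real.exp (-(r / s)) := by
  have hmark := mul_meas_ge_le_integral_of_nonneg (μ := μ)
    (.of_forall fun x => (Real.exp_pos (X x ^ 2 / s)).le) (integrable_exp_sq_div hX h)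
    (Real.exp (r / s))
  have hset : {x | Real.exp (r / s) ≤ Real.exp (X x ^ 2 / s)} = {x | r ≤ X x ^ 2} := by
    ext x
    simp [div_le_div_iff_of_pos_right hs]
  rw [hset] at hmark
  rw [Real.exp_neg, ← div_eq_mul_inv, le_div_iff₀ (Real.exp_pos _), mul_comm]
  exact hmark.trans (integral_exp_sq_div_le hX h)

/-- Second-order Taylor bound whose linear term integrates to zero. The remainder is at most a
multiple of `v² exp v ≤ 2 exp (2v)`, and `2v` exceeds `z²/s` only by `1/(2s)`. -/
theorem exp_mul_sq_sub_le {z s l : ℝ} (hs : 4 ≤ s) (hl : |l| ≤ 1 / (2 * s)) :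
    Real.exp (l * (z ^ 2 - 1 / 2)) ≤
      1 + l * (z ^ 2 - 1 / 2) + 16 * l ^ 2 * s ^ 2 * Real.exp (z ^ 2 / s) := by
  have hs0 : 0 < s := by linarith
  set v : ℝ := (z ^ 2 + 1 / 2) / (2 * s) with hv
  have hv0 : 0 ≤ v := by positivity
  have hw : |z ^ 2 - 1 / 2| ≤ 2 * s * v := by
    have : 2 * s * v = z ^ 2 + 1 / 2 := by rw [hv]; field_simp
    rw [this, abs_le]
    constructor <;> nlinarith [sq_nonneg z]
  have hu : |l * (z ^ 2 - 1 / 2)| ≤ v := by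
    rw [abs_mul]
    calc |l| * |z ^ 2 - 1 / 2| ≤ 1 / (2 * s) * (2 * s * v) := by gcongr
      _ = v := by field_simp
  have hw2 : (z ^ 2 - 1 / 2) ^ 2 ≤ (2 * s * v) ^ 2 := by
    rw [← sq_abs]
    gcongr
  have hexp : Real.exp v * Real.exp v ≤ 2 * Real.exp (z ^ 2 / s) := by
    have h1 : Real.exp (1 / (2 * s)) ≤ 2 := by
      have : Real.exp (1 / (2 * s)) ≤ Real.exp (1 / 2) := by
        refine Real.exp_le_exp.2 ?_
        rw [div_le_div_iff₀ (by positivity) (by norm_num)]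
        linarith
      refine this.trans ?_
      have h2 : Real.exp (1 / 2) ^ 2 = Real.exp 1 := by
        rw [← Real.exp_nat_mul]; norm_num
      nlinarith [Real.exp_one_lt_three, Real.exp_pos (1 / 2)]
    have h3 : v + v = 1 / (2 * s) + z ^ 2 / s := by rw [hv]; field_simp; ring
    rw [← Real.exp_add, h3, Real.exp_add]
    gcongr
  have hmain := exp_le_one_add_add_sq_mul_exp_abs (l * (z ^ 2 - 1 / 2))
  have : (l * (z ^ 2 - 1 / 2)) ^ 2 * Real.exp |l * (z ^ 2 - 1 / 2)| ≤
      16 * l ^ 2 * s ^ 2 * Real.exp (z ^ 2 / s) := by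
    calc (l * (z ^ 2 - 1 / 2)) ^ 2 * Real.exp |l * (z ^ 2 - 1 / 2)|
        ≤ (l ^ 2 * (2 * s * v) ^ 2) * Real.exp v := by
          rw [mul_pow]; gcongr
      _ = 4 * l ^ 2 * s ^ 2 * (v ^ 2 * Real.exp v) := by ring
      _ ≤ 4 * l ^ 2 * s ^ 2 * (2 * Real.exp v * Real.exp v) := by
          gcongr; exact sq_le_two_mul_exp hv0
      _ = 8 * l ^ 2 * s ^ 2 * (Real.exp v * Real.exp v) := by ring
      _ ≤ 8 * l ^ 2 * s ^ 2 * (2 * Real.exp (z ^ 2 / s)) := by gcongr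
      _ = 16 * l ^ 2 * s ^ 2 * Real.exp (z ^ 2 / s) := by ring
  linarith

variable [IsProbabilityMeasure μ]

theorem integrable_exp_mul_sq_sub {X : Ω → ℝ} {s l : ℝ} (hs : 4 ≤ s) (hX : Measurable X)
    (hsq : Integrable (fun x => X x ^ 2) μ)
    (h : ∫⁻ x, ENNReal.ofReal (Real.exp (X x ^ 2 / s)) ∂μ ≤ 2) (hl : |l| ≤ 1 / (2 * s)) :
    Integrable (fun x => Real.exp (l * (X x ^ 2 - 1 / 2))) μ := by
  have hdom : Integrable (fun x => 1 + l * (X x ^ 2 - 1 / 2)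
      + 16 * l ^ 2 * s ^ 2 * Real.exp (X x ^ 2 / s)) μ :=
    ((integrable_const _).add ((hsq.sub (integrable_const _)).const_mul _)).add
      ((integrable_exp_sq_div hX h).const_mul _)
  refine hdom.mono' (by fun_prop) (.of_forall fun x => ?_)
  rw [Real.norm_eq_abs, abs_of_pos (Real.exp_pos _)]
  exact exp_mul_sq_sub_le hs hl

theorem mgf_sq_sub_le {X : Ω → ℝ} {s l : ℝ} (hs : 4 ≤ s) (hX : Measurable X)
    (hsq : Integrable (fun x => X x ^ 2) μ) (hvar : ∫ x, X x ^ 2 ∂μ = 1 / 2)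
    (h : ∫⁻ x, ENNReal.ofReal (Real.exp (X x ^ 2 / s)) ∂μ ≤ 2) (hl : |l| ≤ 1 / (2 * s)) :
    mgf (fun x => X x ^ 2 - 1 / 2) μ l ≤ Real.exp (32 * l ^ 2 * s ^ 2) := by
  have i1 : Integrable (fun x => l * (X x ^ 2 - 1 / 2)) μ :=
    (hsq.sub (integrable_const _)).const_mul _
  have i2 : Integrable (fun x => 16 * l ^ 2 * s ^ 2 * Real.exp (X x ^ 2 / s)) μ :=
    (integrable_exp_sq_div hX h).const_mul _
  have i3 : Integrable (fun x => 1 + l * (X x ^ 2 - 1 / 2)) μ := (integrable_const _).add i1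
  calc mgf (fun x => X x ^ 2 - 1 / 2) μ l
      ≤ ∫ x, (1 + l * (X x ^ 2 - 1 / 2)
          + 16 * l ^ 2 * s ^ 2 * Real.exp (X x ^ 2 / s)) ∂μ :=
        integral_mono (integrable_exp_mul_sq_sub hs hX hsq h hl) (i3.add i2)
          fun x => exp_mul_sq_sub_le hs hl
    _ = 1 + 16 * l ^ 2 * s ^ 2 * ∫ x, Real.exp (X x ^ 2 / s) ∂μ := by
        rw [integral_add i3 i2, integral_add (integrable_const _) i1, integral_const_mul,
          integral_const_mul, integral_sub hsq (integrable_const _), hvar]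
        simp
    _ ≤ 1 + 16 * l ^ 2 * s ^ 2 * 2 := by
        gcongr
        exact integral_exp_sq_div_le hX h
    _ ≤ Real.exp (32 * l ^ 2 * s ^ 2) := by
        have := Real.add_one_le_exp (32 * l ^ 2 * s ^ 2)
        linarith

/-- Bernstein's inequality for a sum of centred squares, either tail being selected by the
sign `ε`. -/
theorem measureReal_sum_sq_sub_ge_le {ι : Type*} [Fintype ι] {Z : ι → Ω → ℝ} {s η ε : ℝ}
    (hε : |ε| = 1) (hs : 4 ≤ s) (hZ : ∀ j, Measurable (Z j)) (hind : iIndepFun Z μ)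
    (hsq : ∀ j, Integrable (fun x => Z j x ^ 2) μ) (hvar : ∀ j, ∫ x, Z j x ^ 2 ∂μ = 1 / 2)
    (h : ∀ j, ∫⁻ x, ENNReal.ofReal (Real.exp (Z j x ^ 2 / s)) ∂μ ≤ 2)
    (hη : 0 ≤ η) (hη1 : η ≤ 1) :
    μ.real {x | Fintype.card ι * η ≤ ε * ∑ j, (Z j x ^ 2 - 1 / 2)} ≤
      Real.exp (-(Fintype.card ι * η ^ 2 / (128 * s ^ 2))) := by
  have hs0 : 0 < s := by linarith
  have hε2 : ε ^ 2 = 1 := by rw [← sq_abs, hε, one_pow]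
  -- The minimiser of `-tη + 32t²s²`, with value `-η²/(128s²)`.
  set t : ℝ := η / (64 * s ^ 2) with ht
  have ht0 : 0 ≤ t := by positivity
  have hl : |t * ε| ≤ 1 / (2 * s) := by
    rw [abs_mul, hε, mul_one, abs_of_nonneg ht0, ht, div_le_div_iff₀ (by positivity) (by positivity)]
    nlinarith
  have hind' : iIndepFun (fun j x => Z j x ^ 2 - 1 / 2) μ :=
    hind.comp (fun _ z => z ^ 2 - 1 / 2) (fun _ => by fun_prop)
  have hmeas : ∀ j, Measurable (fun x => Z j x ^ 2 - 1 / 2) := fun j =>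
    ((hZ j).pow_const 2).sub_const _
  have hmgf : ∫ x, Real.exp (t * ε * ∑ j, (Z j x ^ 2 - 1 / 2)) ∂μ
      ≤ Real.exp (Fintype.card ι * (32 * (t * ε) ^ 2 * s ^ 2)) := by
    have h1 := hind'.mgf_sum (t := t * ε) hmeas Finset.univ
    have h2 : mgf (∑ j, fun x => Z j x ^ 2 - 1 / 2) μ (t * ε)
        = ∫ x, Real.exp (t * ε * ∑ j, (Z j x ^ 2 - 1 / 2)) ∂μ := by
      simp [mgf]
    rw [← h2, h1]
    refine (Finset.prod_le_prod (fun _ _ => mgf_nonneg)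
      fun j _ => mgf_sq_sub_le hs (hZ j) (hsq j) (hvar j) (h j) hl).trans_eq ?_
    rw [Finset.prod_const, Finset.card_univ, ← Real.exp_nat_mul]
  have hint : Integrable (fun x => Real.exp (t * ε * ∑ j, (Z j x ^ 2 - 1 / 2))) μ := by
    have := hind'.integrable_exp_mul_sum (t := t * ε) hmeas (s := Finset.univ)
      fun j _ => integrable_exp_mul_sq_sub hs (hZ j) (hsq j) (h j) hl
    simpa using this
  have hch := measure_ge_le_exp_mul_mgf (μ := μ) (X := fun x => ε * ∑ j, (Z j x ^ 2 - 1 / 2))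
    (Fintype.card ι * η) ht0 (by simpa [mul_assoc] using hint)
  refine hch.trans ?_
  have h3 : mgf (fun x => ε * ∑ j, (Z j x ^ 2 - 1 / 2)) μ t
      ≤ Real.exp (Fintype.card ι * (32 * (t * ε) ^ 2 * s ^ 2)) := by
    simpa [mgf, mul_assoc] using hmgf
  refine (mul_le_mul_of_nonneg_left h3 (Real.exp_pos _).le).trans ?_
  rw [← Real.exp_add, Real.exp_le_exp, mul_pow, hε2, ht]
  apply le_of_eq
  field_simp
  ring

end Subexponential

/-! ### Deterministic estimate and combination of the tails -/

/-- If `∑ b` is close to its mean and no `b k` is large, then the off-diagonal energy is close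
to its mean. -/
theorem abs_two_mul_sub_lt {n : ℕ} (b : Fin n → ℝ) {ω : ℝ} (hb : ∀ k, 0 ≤ b k)
    (hω1 : ω ≤ 1) (hn : 16 ≤ n * ω) (hS : |∑ k, b k - n| < n * ω / 8)
    (hmax : ∀ k, b k ≤ n * ω / 32) :
    |2 * ((∑ k, b k) ^ 2 - ∑ k, b k ^ 2) - 2 * (n : ℝ) * ((n : ℝ) - 1)|
      < 2 * (n : ℝ) * ((n : ℝ) - 1) * ω := by
  have hsq : ∑ k, b k ^ 2 ≤ n * ω / 32 * ∑ k, b k := by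
    rw [Finset.mul_sum]
    refine Finset.sum_le_sum fun k _ => ?_
    rw [sq]
    exact mul_le_mul_of_nonneg_right (hmax k) (hb k)
  have hsq0 : 0 ≤ ∑ k, b k ^ 2 := Finset.sum_nonneg fun k _ => sq_nonneg _
  have hr0 : (0 : ℝ) ≤ n := n.cast_nonneg
  generalize ∑ k, b k ^ 2 = T at *
  generalize ∑ k, b k = S at *
  generalize (n : ℝ) = r at *
  obtain ⟨hS1, hS2⟩ := abs_lt.1 hS
  have hr : 16 ≤ r := by nlinarith
  have her : r * ω ≤ r := by nlinarith
  have hrhs : 2 * r * (r - 1) * ω = 2 * ((r - 1) * (r * ω)) := by ring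
  rw [hrhs]
  generalize r * ω = e at *
  have hTe : T ≤ r * e / 16 := by
    have : e / 32 * S ≤ e / 32 * (2 * r) :=
      mul_le_mul_of_nonneg_left (by linarith) (by linarith)
    linarith
  have hup : S ^ 2 ≤ (r + e / 8) ^ 2 := pow_le_pow_left₀ (by linarith) (by linarith) 2
  have hlow : (r - e / 8) ^ 2 ≤ S ^ 2 := pow_le_pow_left₀ (by linarith) (by linarith) 2
  have hre : e * e ≤ r * e := mul_le_mul_of_nonneg_right her (by linarith)
  -- `16 ≤ nω` makes the lower-order terms `r` and `e` small against `r * e`.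
  have hr16 : 16 * r ≤ r * e := by nlinarith
  have he16 : 16 * e ≤ r * e := by nlinarith
  rw [abs_lt]
  constructor <;> nlinarith

/-- Since `n x = y²` and `x ≥ 2²⁴`, the prefactor `n` is at most `(y/2¹²)²`, hence dominated by a
small part of the decay `exp (-y/256)`; then `x ≤ y` returns to the Bernstein exponent. -/
theorem exp_tail_combine {n ω ψ : ℝ} (hψ : 1 ≤ ψ) (hω : 0 ≤ ω) (hω1 : ω ≤ 1) (hn : 0 ≤ n)
    (hx : 2 ^ 24 ≤ ω ^ 2 / ψ ^ 4 * n) :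
    2 * Real.exp (-(2 * n * (ω / 16) ^ 2 / (128 * (4 * ψ ^ 2) ^ 2)))
      + 2 * n * (2 * Real.exp (-(n * ω / 64 / (4 * ψ ^ 2))))
      ≤ 2 * Real.exp (-(1 / 2 ^ 25 * (ω ^ 2 / ψ ^ 4) * n)) := by
  have hψ0 : 0 < ψ := by linarith
  set x : ℝ := ω ^ 2 / ψ ^ 4 * n with hxdef
  set y : ℝ := n * ω / ψ ^ 2 with hydef
  have hy0 : 0 ≤ y := by positivity
  have hnx : n * x = y ^ 2 := by rw [hxdef, hydef]; field_simp
  have hxy : x ≤ y := by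
    have hq : ω / ψ ^ 2 ≤ 1 := (div_le_one (by positivity)).2 (hω1.trans (one_le_pow₀ hψ))
    have : x = y * (ω / ψ ^ 2) := by rw [hxdef, hydef]; field_simp
    rw [this]
    exact mul_le_of_le_one_right hy0 hq
  have e1 : 2 * n * (ω / 16) ^ 2 / (128 * (4 * ψ ^ 2) ^ 2) = x / 2 ^ 18 := by
    rw [hxdef]; field_simp; ring
  have e2 : n * ω / 64 / (4 * ψ ^ 2) = y / 256 := by
    rw [hydef]; field_simp; ring
  have e3 : 1 / 2 ^ 25 * (ω ^ 2 / ψ ^ 4) * n = x / 2 ^ 25 := by rw [hxdef]; ring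
  rw [e1, e2, e3]
  have hn4 : 4 * n ≤ 1 / 2 * Real.exp (y / 1024) := by
    have h1 := sq_le_two_mul_exp (v := y / 1024) (by positivity)
    have h2 : n * 2 ^ 24 ≤ y ^ 2 := hnx ▸ mul_le_mul_of_nonneg_left hx hn
    rw [div_pow] at h1
    linarith
  have hsecond : 2 * n * (2 * Real.exp (-(y / 256))) ≤ 1 / 2 * Real.exp (-(x / 2 ^ 18)) := by
    calc 2 * n * (2 * Real.exp (-(y / 256))) = 4 * n * Real.exp (-(y / 256)) := by ring
      _ ≤ 1 / 2 * Real.exp (y / 1024) * Real.exp (-(y / 256)) := by gcongr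
      _ = 1 / 2 * Real.exp (y / 1024 + -(y / 256)) := by rw [Real.exp_add]; ring
      _ ≤ 1 / 2 * Real.exp (-(x / 2 ^ 18)) := by
        gcongr
        linarith
  have hgap : 5 / 4 * Real.exp (-(x / 2 ^ 18)) ≤ Real.exp (-(x / 2 ^ 25)) := by
    have hsplit : -(x / 2 ^ 25) = (x / 2 ^ 18 - x / 2 ^ 25) + -(x / 2 ^ 18) := by ring
    rw [hsplit, Real.exp_add]
    refine mul_le_mul_of_nonneg_right ?_ (Real.exp_pos _).le
    have := Real.add_one_le_exp (x / 2 ^ 18 - x / 2 ^ 25)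
    linarith
  linarith

/-! ### Moments and deviation of the off-diagonal energy -/

namespace SubgaussianModel

variable {Ω : Type*} [MeasurableSpace Ω] {μ : Measure Ω} {N n : ℕ}
  {a : Fin N → Ω → Fin n → ℂ} {ψ : ℝ}

/-- The real and imaginary parts of the coordinates of the `i`-th vector. -/
def part (a : Fin N → Ω → Fin n → ℂ) (i : Fin N) : Fin n ⊕ Fin n → Ω → ℝ :=
  Sum.elim (fun k x => (a i x k).re) (fun k x => (a i x k).im)

theorem measurable_part (h : SubgaussianModel μ a ψ) (i : Fin N) (j : Fin n ⊕ Fin n) :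
    Measurable (part a i j) := by
  rcases j with k | k
  · exact Complex.measurable_re.comp ((measurable_pi_apply k).comp (h.measurable i))
  · exact Complex.measurable_im.comp ((measurable_pi_apply k).comp (h.measurable i))

theorem integral_part_sq (h : SubgaussianModel μ a ψ) (i : Fin N) (j : Fin n ⊕ Fin n) :
    ∫ x, part a i j x ^ 2 ∂μ = 1 / 2 := by
  rcases j with k | k
  · exact h.sq_re i k
  · exact h.sq_im i k

theorem integrable_part_sq (h : SubgaussianModel μ a ψ) (i : Fin N) (j : Fin n ⊕ Fin n) :
    Integrable (fun x => part a i j x ^ 2) μ := by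
  -- A non-integrable function has Bochner integral 0, not `1/2`.
  by_contra hc
  have := h.integral_part_sq i j
  rw [integral_undef hc] at this
  norm_num at this

theorem lintegral_exp_part (h : SubgaussianModel μ a ψ) (i : Fin N) (j : Fin n ⊕ Fin n) :
    ∫⁻ x, ENNReal.ofReal (Real.exp (part a i j x ^ 2 / (4 * ψ ^ 2))) ∂μ ≤ 2 := by
  have hψ : 0 < ψ := zero_lt_one.trans_le h.one_le
  rcases j with k | k
  · exact lintegral_exp_sq_le_of_psiNorm_le hψ (h.psi_re i k)
  · exact lintegral_exp_sq_le_of_psiNorm_le hψ (h.psi_im i k)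

theorem indepFun_part_sq (h : SubgaussianModel μ a ψ) (i : Fin N) {j l : Fin n ⊕ Fin n}
    (hjl : j ≠ l) : IndepFun (fun x => part a i j x ^ 2) (fun x => part a i l x ^ 2) μ :=
  ((h.indep_parts i).indepFun hjl).comp (φ := fun z => z ^ 2) (ψ := fun z => z ^ 2)
    (by fun_prop) (by fun_prop)

theorem integrable_part_sq_mul (h : SubgaussianModel μ a ψ) (i : Fin N) {j l : Fin n ⊕ Fin n}
    (hjl : j ≠ l) : Integrable (fun x => part a i j x ^ 2 * part a i l x ^ 2) μ :=
  (h.indepFun_part_sq i hjl).integrable_mul (h.integrable_part_sq i j) (h.integrable_part_sq i l)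

theorem integral_part_sq_mul (h : SubgaussianModel μ a ψ) (i : Fin N) {j l : Fin n ⊕ Fin n}
    (hjl : j ≠ l) : ∫ x, part a i j x ^ 2 * part a i l x ^ 2 ∂μ = 1 / 4 := by
  rw [(h.indepFun_part_sq i hjl).integral_fun_mul_eq_mul_integral
    (h.integrable_part_sq i j).aestronglyMeasurable
    (h.integrable_part_sq i l).aestronglyMeasurable, h.integral_part_sq, h.integral_part_sq]
  norm_num

theorem integrable_mul_and_integral_eq_one (h : SubgaussianModel μ a ψ) (i : Fin N) (p : OffDiag n) :
    Integrable (fun x => ((a i x p.1.1).re ^ 2 + (a i x p.1.1).im ^ 2) *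
      ((a i x p.1.2).re ^ 2 + (a i x p.1.2).im ^ 2)) μ ∧
    ∫ x, ((a i x p.1.1).re ^ 2 + (a i x p.1.1).im ^ 2) *
      ((a i x p.1.2).re ^ 2 + (a i x p.1.2).im ^ 2) ∂μ = 1 := by
  obtain ⟨⟨k, l⟩, hkl⟩ := p
  dsimp only at hkl ⊢
  have heq : (fun x => ((a i x k).re ^ 2 + (a i x k).im ^ 2) *
      ((a i x l).re ^ 2 + (a i x l).im ^ 2)) = fun x =>
      (part a i (.inl k) x ^ 2 * part a i (.inl l) x ^ 2
        + part a i (.inl k) x ^ 2 * part a i (.inr l) x ^ 2)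
      + (part a i (.inr k) x ^ 2 * part a i (.inl l) x ^ 2
        + part a i (.inr k) x ^ 2 * part a i (.inr l) x ^ 2) := by
    funext x
    simp only [part, Sum.elim_inl, Sum.elim_inr]
    ring
  have n1 : (Sum.inl k : Fin n ⊕ Fin n) ≠ .inl l := by simpa using hkl
  have n2 : (Sum.inl k : Fin n ⊕ Fin n) ≠ .inr l := by simp
  have n3 : (Sum.inr k : Fin n ⊕ Fin n) ≠ .inl l := by simp
  have n4 : (Sum.inr k : Fin n ⊕ Fin n) ≠ .inr l := by simpa using hkl
  have i1 := h.integrable_part_sq_mul i n1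
  have i2 := h.integrable_part_sq_mul i n2
  have i3 := h.integrable_part_sq_mul i n3
  have i4 := h.integrable_part_sq_mul i n4
  have i12 : Integrable (fun x => part a i (.inl k) x ^ 2 * part a i (.inl l) x ^ 2
    + part a i (.inl k) x ^ 2 * part a i (.inr l) x ^ 2) μ := i1.add i2
  have i34 : Integrable (fun x => part a i (.inr k) x ^ 2 * part a i (.inl l) x ^ 2
    + part a i (.inr k) x ^ 2 * part a i (.inr l) x ^ 2) μ := i3.add i4
  rw [heq]
  refine ⟨i12.add i34, ?_⟩
  rw [integral_add i12 i34, integral_add i1 i2, integral_add i3 i4,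
    h.integral_part_sq_mul i n1, h.integral_part_sq_mul i n2, h.integral_part_sq_mul i n3,
    h.integral_part_sq_mul i n4]
  norm_num

theorem integrable_norm_sq (h : SubgaussianModel μ a ψ) (i : Fin N) :
    Integrable (fun x => ‖outerOffDiag (a i) x‖ ^ 2) μ := by
  simp only [norm_sq_outerOffDiag]
  exact (integrable_finsetSum _ fun p _ => (h.integrable_mul_and_integral_eq_one i p).1).const_mul 2

theorem integral_norm_sq (h : SubgaussianModel μ a ψ) (i : Fin N) :
    ∫ x, ‖outerOffDiag (a i) x‖ ^ 2 ∂μ = 2 * (n : ℝ) * ((n : ℝ) - 1) := by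
  simp only [norm_sq_outerOffDiag]
  rw [integral_const_mul, integral_finsetSum _ fun p _ => (h.integrable_mul_and_integral_eq_one i p).1,
    Finset.sum_congr rfl fun p _ => (h.integrable_mul_and_integral_eq_one i p).2]
  have := sum_offDiag_mul (n := n) fun _ => 1
  simp only [mul_one, one_pow, Finset.sum_const, Finset.card_univ, Fintype.card_fin,
    nsmul_eq_mul] at this ⊢
  rw [this]
  ring

variable [IsProbabilityMeasure μ]

theorem measureReal_abs_norm_sq_sub_ge_le (h : SubgaussianModel μ a ψ) (i : Fin N) {ω : ℝ}
    (hω : 0 ≤ ω) (hω1 : ω ≤ 1) (hn : 16 ≤ n * ω) :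
    μ.real {x | 2 * (n : ℝ) * ((n : ℝ) - 1) * ω
        ≤ |‖outerOffDiag (a i) x‖ ^ 2 - 2 * (n : ℝ) * ((n : ℝ) - 1)|} ≤
      2 * Real.exp (-(2 * n * (ω / 16) ^ 2 / (128 * (4 * ψ ^ 2) ^ 2)))
      + 2 * n * (2 * Real.exp (-(n * ω / 64 / (4 * ψ ^ 2)))) := by
  have hs : 4 ≤ 4 * ψ ^ 2 := by nlinarith [h.one_le]
  have hcard : (Fintype.card (Fin n ⊕ Fin n) : ℝ) = 2 * n := by
    simp
    ring
  -- Thresholds: `2n · ω/16 = nω/8` for the sum; `nω/64` per part, as each `b k` is a sum of two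
  -- squares.
  set U : ℝ → Set Ω := fun ε => {x | (Fintype.card (Fin n ⊕ Fin n) : ℝ) * (ω / 16)
    ≤ ε * ∑ j, (part a i j x ^ 2 - 1 / 2)} with hU
  set V : Fin n ⊕ Fin n → Set Ω := fun j => {x | n * ω / 64 ≤ part a i j x ^ 2} with hV
  have hsub : {x | 2 * (n : ℝ) * ((n : ℝ) - 1) * ω
        ≤ |‖outerOffDiag (a i) x‖ ^ 2 - 2 * (n : ℝ) * ((n : ℝ) - 1)|}
      ⊆ (U 1 ∪ U (-1)) ∪ ⋃ j, V j := by
    intro x hx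
    by_contra hc
    simp only [hU, hV, Set.mem_union, Set.mem_iUnion, Set.mem_ofPred_eq, not_or, not_exists,
      not_le, hcard, Fintype.sum_sum_type, part, Sum.elim_inl, Sum.elim_inr,
      Finset.sum_sub_distrib, Finset.sum_const, Finset.card_univ, nsmul_eq_mul] at hc
    obtain ⟨⟨h1, h2⟩, h3⟩ := hc
    rw [Set.mem_ofPred_eq, norm_sq_outerOffDiag,
      sum_offDiag_mul fun k => (a i x k).re ^ 2 + (a i x k).im ^ 2] at hx
    refine absurd hx (not_le.2 (abs_two_mul_sub_lt _ (fun k => by positivity) hω1 hn ?_ ?_))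
    · rw [Finset.sum_add_distrib, abs_lt]
      constructor <;> linarith
    · intro k
      have h4 := h3 (.inl k)
      have h5 := h3 (.inr k)
      simp only [Sum.elim_inl, Sum.elim_inr] at h4 h5
      linarith
  have hUle : ∀ ε : ℝ, |ε| = 1 → μ.real (U ε) ≤
      Real.exp (-(2 * n * (ω / 16) ^ 2 / (128 * (4 * ψ ^ 2) ^ 2))) := by
    intro ε hε
    have := measureReal_sum_sq_sub_ge_le hε hs (h.measurable_part i) (h.indep_parts i)
      (h.integrable_part_sq i) (h.integral_part_sq i) (h.lintegral_exp_part i)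
      (η := ω / 16) (by positivity) (by linarith)
    simpa only [hU, hcard] using this
  have hVle : μ.real (⋃ j, V j) ≤ 2 * n * (2 * Real.exp (-(n * ω / 64 / (4 * ψ ^ 2)))) := by
    refine (measureReal_iUnion_fintype_le V).trans ?_
    refine (Finset.sum_le_sum fun j _ => measureReal_sq_ge_le (by linarith)
      (h.measurable_part i j) (h.lintegral_exp_part i j) _).trans_eq ?_
    rw [Finset.sum_const, Finset.card_univ, nsmul_eq_mul, hcard]
  have hU1 := hUle 1 (by simp)
  have hU2 := hUle (-1) (by simp)
  have := (measureReal_mono hsub (measure_ne_top μ _)).trans (measureReal_union_le _ _)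
  have := measureReal_union_le (μ := μ) (U 1) (U (-1))
  linarith

end SubgaussianModel

theorem mainTheorem7 :
    ∃ γ : ℝ, 0 < γ ∧ γ < 1 ∧
      ∀ {Ω : Type*} [MeasurableSpace Ω] (μ : Measure Ω) [IsProbabilityMeasure μ]
        (N n : ℕ) (a : Fin N → Ω → Fin n → ℂ) (ψ : ℝ) (m : ℝ),
        SubgaussianModel μ a ψ → m = 2 * (n : ℝ) * ((n : ℝ) - 1) →
        ∀ i : Fin N,
          (Integrable (fun x => ‖outerOffDiag (a i) x‖ ^ 2) μ ∧
            ∫ x, ‖outerOffDiag (a i) x‖ ^ 2 ∂μ = m) ∧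
          (ψ ^ 4 ≤ (n : ℝ) → ∀ ω : ℝ, 0 ≤ ω → ω ≤ 1 →
            μ.real {x | m * ω ≤ |‖outerOffDiag (a i) x‖ ^ 2 - m|} ≤
              2 * Real.exp (-(γ * (ω ^ 2 / ψ ^ 4) * (n : ℝ)))) := by
  refine ⟨1 / 2 ^ 25, by norm_num, by norm_num, ?_⟩
  intro Ω _ μ _ N n a ψ m h hm i
  subst hm
  refine ⟨⟨h.integrable_norm_sq i, h.integral_norm_sq i⟩, fun _ ω hω hω1 => ?_⟩
  have hψ := h.one_le
  rcases le_total (2 ^ 24) (ω ^ 2 / ψ ^ 4 * n) with hx | hx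
  · have hxn : ω ^ 2 / ψ ^ 4 * n ≤ n * ω := by
      have h1 : ω ^ 2 / ψ ^ 4 ≤ ω :=
        (div_le_self (sq_nonneg _) (one_le_pow₀ hψ)).trans (by nlinarith)
      nlinarith [n.cast_nonneg (α := ℝ)]
    exact (h.measureReal_abs_norm_sq_sub_ge_le i hω hω1 (by linarith)).trans
      (exp_tail_combine hψ hω hω1 n.cast_nonneg hx)
  -- Here the exponent is at least `-1/2`, so `2 exp(·) ≥ 2(1 - 1/2) = 1`.
  · refine measureReal_le_one.trans ?_
    have := Real.add_one_le_exp (-(1 / 2 ^ 25 * (ω ^ 2 / ψ ^ 4) * (n : ℝ)))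
    linarith
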